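/- Let $K$ be a (totally) ordered field, let $V$ be a (totally) ordered vector space over $K$, and let $W\subsetneq V$ be a proper $K$-linear subspace that is dense in $V$, i.e. for all $a<b$ in $V$ there is $w\in W$ with $a<w<b$. Let $L$ be the first-order language $\{+,-,0,1,<\}\cup\{\ell_\lambda:\lambda\in K\}\cup\{U\}$, with $\ell_\lambda$ a unary function symbol for each $\lambda\in K$ and $U$ a unary relation symbol. Let $(V,W)$ denote the $L$-structure with underlying set $V$ in which $+,-,0,<$ have their usual meaning, $1$ is interpreted as some fixed positive element of $W$, $\ell_\lambda$ as scalar multiplication $v\mapsto\lambda v$, and $U$ as the subset $W$. For an $L$-formula $\varphi(x;y)$ whose free variables are partitioned into object variables $x=(x_1,\dots,x_m)$ and parameter variables $y=(y_1,\dots,y_n)$, and for $b\in V^n$, put $\varphi(V;b)=\{a\in V^m:(V,W)\models\varphi(a;b)\}$. The shatter function of $\varphi(x;y)$ in $(V,W)$ is $$\pi_\varphi(k)=\max\bigl\{\,\bigl|\{A\cap\varphi(V;b):b\in V^n\}\bigr| : A\subseteq V^m,\ |A|=k\,\bigr\}\qquad(k\in\mathbb N)$$ (with $\max\emptyset=0$),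 and the VC-density of $\varphi(x;y)$ in $(V,W)$ is the infimum, in $\mathbb R\cup\{\pm\infty\}$, of the real numbers $r$ such that $\pi_\varphi(k)=O(k^r)$ as $k\to\infty$ (so it is $+\infty$ if there is no such $r$). Then for all $m,n\ge 0$, every partitioned $L$-formula $\varphi(x;y)$ with $|x|=m$ and $|y|=n$ has VC-density at most $2n=2|y|$ in $(V,W)$. -/

import Mathlib

open Asymptotics Filter

universe u v w

/-! ### VC-density of partitioned formulas -/

section VCDensity

variable {L : FirstOrder.Language.{u, v}} (M : Type w) [L.Structure M]

/-- For a partitioned formula `φ(x; y)`, with object variables indexed by `Fin m` and parameter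
variables indexed by `Fin n`, the subset `φ(M; b)` of `M ^ m` defined by the parameter tuple `b`. -/
def definedSet {m n : ℕ} (φ : L.Formula (Fin m ⊕ Fin n)) (b : Fin n → M) : Set (Fin m → M) :=
  {a | φ.Realize (Sum.elim a b)}

/-- The collection `A ∩ φ(M; y)` of all the sets `A ∩ φ(M; b)`, with `b` ranging over `M ^ n`. -/
def traceFamily {m n : ℕ} (φ : L.Formula (Fin m ⊕ Fin n)) (A : Set (Fin m → M)) :
    Set (Set (Fin m → M)) :=
  {S | ∃ b : Fin n → M, S = A ∩ definedSet M φ b}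

/-- The shatter function `π_φ(k)`: the maximal size of `A ∩ φ(M; y)` over the subsets `A` of `M ^ m`
with exactly `k` elements (these sizes are at most `2 ^ k`, so the supremum is a maximum;
the value is `0` if `M ^ m` has no subset with `k` elements). -/
noncomputable def shatterFunction {m n : ℕ} (φ : L.Formula (Fin m ⊕ Fin n)) (k : ℕ) : ℕ :=
  sSup {c : ℕ | ∃ A : Finset (Fin m → M), A.card = k ∧
    c = (traceFamily M φ (A : Set (Fin m → M))).ncard}

/-- The VC-density of `φ(x; y)`: the infimum of the real numbers `r` with `π_φ(k) = O(k ^ r)`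
as `k → ∞`, taken in the extended reals, so that it is `∞` if there is no such `r`. -/
noncomputable def vcDensity {m n : ℕ} (φ : L.Formula (Fin m ⊕ Fin n)) : EReal :=
  sInf {s : EReal | ∃ r : ℝ, s = (r : EReal) ∧
    (fun k : ℕ => (shatterFunction M φ k : ℝ)) =O[atTop] (fun k : ℕ => (k : ℝ) ^ r)}

end VCDensity

/-! ### Pairs of ordered vector spaces -/

/-- Function symbols `0`, `1`, `+`, `-` (unary minus) and `ℓ_c`, for `c` in `K`. -/
inductive OvsFunctions (K : Type u) : ℕ → Type u
  | zero : OvsFunctions K 0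
  | one : OvsFunctions K 0
  | neg : OvsFunctions K 1
  | smul (c : K) : OvsFunctions K 1
  | add : OvsFunctions K 2

/-- Relation symbols `<` and `U`. -/
inductive OvsPairRelations : ℕ → Type
  | U : OvsPairRelations 1
  | lt : OvsPairRelations 2

/-- The language of ordered vector spaces over `K` with a constant symbol `1`, enriched by
a unary relation symbol `U`. -/
def ovsPairLanguage (K : Type u) : FirstOrder.Language.{u, 0} :=
  ⟨OvsFunctions K, OvsPairRelations⟩

/-- The structure `(V, W)`: the symbol `1` is interpreted as `e`, the symbol `U` as `W`, and all
the other symbols have their usual meaning. -/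
abbrev ovsPairStructure {K : Type u} {V : Type v} [Field K] [AddCommGroup V] [LinearOrder V]
    [Module K V] (W : Submodule K V) (e : V) : (ovsPairLanguage K).Structure V where
  funMap := fun {_} f =>
    match f with
    | OvsFunctions.zero => fun _ => 0
    | OvsFunctions.one => fun _ => e
    | OvsFunctions.neg => fun t => - t 0
    | OvsFunctions.smul c => fun t => c • t 0
    | OvsFunctions.add => fun t => t 0 + t 1
  RelMap := fun {_} R =>
    match R with
    | OvsPairRelations.U => fun t => t 0 ∈ W
    | OvsPairRelations.lt => fun t => t 0 < t 1

/-!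
The proof has two halves: quantifier elimination for the pair `(V, W)`, and a count of patterns of
affine forms.

*Quantifier elimination.* The truth value of a formula at a point of a power of `V` depends only on
the signs, and the memberships in `W`, of finitely many affine forms at that point
(`exists_finite_samePattern_realize_iff`). The only case that matters in the induction on formulas
is that of a quantifier over a variable `t`, which is handled by back-and-forth: a form `q + c • t`
with `c ≠ 0` compares `t` with its root `-c⁻¹ • q`, and if the roots at two points are ordered in
the same way and are congruent modulo `W` for the same pairs, then each value of `t` at one point
has a counterpart at the other (`exists_extension`). Indeed, all the cosets of `W` are dense in `V`,
and infinitely many of them exist, so every open interval meets any given coset, and also meets the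
complement of any finite union of cosets.

*Counting.* Let `N` affine forms on `V ^ n` be given. Once the position of the last coordinate `t`
among the roots is specified by the largest root that is at most `t`, together with whether it
equals `t`, the signs of all the forms can be read off from the signs of `N` affine forms in the
other coordinates: the differences of the chosen root with the other roots, and the forms that do
not involve `t`. So each coordinate contributes a factor `2 * N + 1`, whence at most
`(2 * N + 1) ^ n` sign patterns (`ncard_range_sign_pattern_le`). In the same way, choosing a root
that is congruent to `t` modulo `W`, if there is one, gives at most `(N + 1) ^ n` patterns of
membership in `W` (`ncard_range_mem_pattern_le`).

For a set `A` of `k` values of the object variables, a formula gives rise to `N * k` affine forms in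
the parameters, with `N` independent of `A`. Hence the trace family on `A` has at most
`(2 * N * k + 1) ^ n * (N * k + 1) ^ n` members, which is `O(k ^ (2 * n))`.
-/

/-! ### Affine forms -/

section AffineForms

variable {K : Type u} {V : Type v} [Field K] [AddCommGroup V] [Module K V]

/-- The affine form `x ↦ ∑ i, μ i • x i + c` on `V ^ β`, encoded by the pair `(μ, c)`; it depends
linearly on this pair. The constant term may be any vector, so that some of the variables of a form
can be specialized. -/
def affineForm {β : Type*} [Fintype β] : ((β → K) × V) →ₗ[K] (β → V) → V where
  toFun f x := ∑ i, f.1 i • x i + f.2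
  map_add' f g := by
    ext x
    simp only [Prod.fst_add, Pi.add_apply, add_smul, Finset.sum_add_distrib, Prod.snd_add]
    abel
  map_smul' c f := by
    ext x
    simp [Finset.smul_sum, smul_smul]

theorem affineForm_apply {β : Type*} [Fintype β] (f : (β → K) × V) (x : β → V) :
    affineForm f x = ∑ i, f.1 i • x i + f.2 := rfl

theorem affineForm_snoc {n : ℕ} (f : (Fin (n + 1) → K) × V) (x : Fin n → V) (t : V) :
    affineForm f (Fin.snoc x t : Fin (n + 1) → V) =
      affineForm (Fin.init f.1, f.2) x + f.1 (Fin.last n) • t := by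
  simp only [affineForm_apply, Fin.sum_univ_castSucc, Fin.snoc_castSucc, Fin.snoc_last, Fin.init]
  abel

theorem affineForm_sumElim {α β : Type*} [Fintype α] [Fintype β] (f : (α ⊕ β → K) × V)
    (a : α → V) (b : β → V) :
    affineForm f (Sum.elim a b) =
      affineForm (f.1 ∘ Sum.inr, affineForm (f.1 ∘ Sum.inl, f.2) a) b := by
  simp only [affineForm_apply, Fintype.sum_sum_type, Sum.elim_inl, Sum.elim_inr,
    Function.comp_apply]
  abel

theorem affineForm_sumElim_snoc {α : Type*} [Fintype α] {n : ℕ}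
    (f : (α ⊕ Fin (n + 1) → K) × V) (a : α → V) (x : Fin n → V) (t : V) :
    affineForm f (Sum.elim a (Fin.snoc x t : Fin (n + 1) → V)) =
      affineForm (Sum.elim (f.1 ∘ Sum.inl) (Fin.init (f.1 ∘ Sum.inr)), f.2) (Sum.elim a x) +
        f.1 (Sum.inr (Fin.last n)) • t := by
  simp only [affineForm_sumElim, affineForm_snoc]
  rfl

/-- Every term defines an affine form. -/
theorem exists_affineForm_eq_realize [LinearOrder V] (W : Submodule K V) (e : V) {β : Type*}
    [Fintype β] (t : (ovsPairLanguage K).Term β) :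
    letI : (ovsPairLanguage K).Structure V := ovsPairStructure W e
    ∃ f : (β → K) × V, ∀ x : β → V, t.realize x = affineForm f x := by
  classical
  let : (ovsPairLanguage K).Structure V := ovsPairStructure W e
  induction t with
  | var i =>
    refine ⟨(Pi.single i 1, 0), fun x => ?_⟩
    simp [affineForm_apply, Pi.single_apply]
  | func F ts ih =>
    choose f hf using ih
    cases F with
    | zero => exact ⟨0, fun x => by rw [map_zero]; rfl⟩
    | one => exact ⟨(0, e), fun x => by simp [affineForm_apply]; rfl⟩
    | neg =>
      refine ⟨-f 0, fun x => ?_⟩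
      rw [map_neg, Pi.neg_apply, ← hf]
      rfl
    | smul c =>
      refine ⟨c • f 0, fun x => ?_⟩
      rw [map_smul, Pi.smul_apply, ← hf]
      rfl
    | add =>
      refine ⟨f 0 + f 1, fun x => ?_⟩
      rw [map_add, Pi.add_apply, ← hf, ← hf]
      rfl

end AffineForms

theorem sign_smul_eq_mul {K : Type u} {V : Type v} [Field K] [LinearOrder K]
    [IsStrictOrderedRing K] [AddCommGroup V] [LinearOrder V] [IsOrderedAddMonoid V] [Module K V]
    [IsOrderedModule K V] (c : K) (x : V) :
    SignType.sign (c • x) = SignType.sign c * SignType.sign x := by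
  have : PosSMulStrictMono K V := PosSMulMono.toPosSMulStrictMono
  have : SMulPosStrictMono K V := SMulPosMono.toSMulPosStrictMono
  rcases lt_trichotomy c 0 with hc | rfl | hc <;> rcases lt_trichotomy x 0 with hx | rfl | hx
  · simp [sign_neg hc, sign_neg hx, sign_pos (smul_pos_of_neg_of_neg hc hx)]
  · simp
  · simp [sign_neg hc, sign_pos hx, sign_neg (smul_neg_of_neg_of_pos hc hx)]
  · simp
  · simp
  · simp
  · simp [sign_pos hc, sign_neg hx, sign_neg (smul_neg_of_pos_of_neg hc hx)]
  · simp
  · simp [sign_pos hc, sign_pos hx, sign_pos (smul_pos hc hx)]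

/-! ### Quantifier elimination -/

section QuantifierElimination

variable {K : Type u} {V : Type v} [Field K] [AddCommGroup V] [Module K V]

/-- As `K` is infinite and `W ≠ V`, finitely many cosets of `W` do not cover `V`. -/
theorem exists_forall_sub_notMem [LinearOrder K] [IsStrictOrderedRing K]
    {W : Submodule K V} (hproper : W ≠ ⊤) {ι : Type*} [Finite ι]
    (c : ι → V) : ∃ u, ∀ i, u - c i ∉ W := by
  obtain ⟨u, -, hu⟩ := SetLike.exists_of_lt hproper.lt_top
  by_contra! h
  choose i hi using fun t : ℕ => h ((t : K) • u)
  obtain ⟨s, t, hst, hi'⟩ := Finite.exists_ne_map_eq_of_infinite i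
  have h1 := W.sub_mem (hi s) (hi t)
  rw [hi', sub_sub_sub_cancel_right, ← sub_smul] at h1
  exact hu ((W.smul_mem_iff (sub_ne_zero.2 (Nat.cast_injective.ne hst))).1 h1)

variable [LinearOrder V]

/-- The forms in `F` have the same signs and the same memberships in `W` at `x` as at `x'`. -/
def SamePattern (W : Submodule K V) {β : Type*} [Fintype β] (F : Set ((β → K) × V))
    (x x' : β → V) : Prop :=
  ∀ f ∈ F, SignType.sign (affineForm f x) = SignType.sign (affineForm f x') ∧
    (affineForm f x ∈ W ↔ affineForm f x' ∈ W)

theorem SamePattern.symm {W : Submodule K V} {β : Type*} [Fintype β] {F : Set ((β → K) × V)}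
    {x x' : β → V} (h : SamePattern W F x x') : SamePattern W F x' x :=
  fun f hf => ⟨(h f hf).1.symm, (h f hf).2.symm⟩

theorem SamePattern.mono {W : Submodule K V} {β : Type*} [Fintype β] {F G : Set ((β → K) × V)}
    (hFG : F ⊆ G) {x x' : β → V} (h : SamePattern W G x x') : SamePattern W F x x' :=
  fun f hf => h f (hFG hf)

variable [IsOrderedAddMonoid V]

theorem exists_sub_mem_between {W : Submodule K V}
    (hdense : ∀ a b : V, a < b → ∃ w ∈ W, a < w ∧ w < b) (c : V) {a b : V} (hab : a < b) :
    ∃ x, x - c ∈ W ∧ a < x ∧ x < b := by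
  obtain ⟨w, hw, h1, h2⟩ := hdense (a - c) (b - c) (sub_lt_sub_right hab c)
  exact ⟨w + c, by simpa using hw, sub_lt_iff_lt_add.1 h1, lt_sub_iff_add_lt.1 h2⟩

variable [LinearOrder K] [IsStrictOrderedRing K]

/-- Two finite families of points of `V` with the same order type and the same congruences modulo
`W` realize the same one-point extensions. -/
theorem exists_extension {W : Submodule K V} (hproper : W ≠ ⊤)
    (hdense : ∀ a b : V, a < b → ∃ w ∈ W, a < w ∧ w < b) {ι : Type*} [Finite ι] {p p' : ι → V}
    (hsign : ∀ i j, SignType.sign (p j - p i) = SignType.sign (p' j - p' i))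
    (hmem : ∀ i j, p j - p i ∈ W ↔ p' j - p' i ∈ W) (x : V) :
    ∃ x', ∀ i, SignType.sign (x - p i) = SignType.sign (x' - p' i) ∧
      (x - p i ∈ W ↔ x' - p' i ∈ W) := by
  classical
  by_cases hx : ∃ j, p j = x
  · obtain ⟨j, rfl⟩ := hx
    exact ⟨p' j, fun i => ⟨hsign i j, hmem i j⟩⟩
  push Not at hx
  have := Fintype.ofFinite ι
  -- The cut of `x` in the first family determines a nonempty open interval for `x'`.
  obtain ⟨a, b, hab, ha, hb⟩ : ∃ a b : V, a < b ∧ (∀ i, p i < x → p' i < a) ∧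
      ∀ i, x < p i → b < p' i := by
    obtain ⟨u, -, hu⟩ := SetLike.exists_of_lt hproper.lt_top
    have : Nontrivial V := ⟨u, 0, fun h => hu (h ▸ W.zero_mem)⟩
    have : DenselyOrdered V := ⟨fun a b hab => by
      obtain ⟨w, -, hw⟩ := hdense a b hab
      exact ⟨w, hw⟩⟩
    have hlohi : ∀ y ∈ (Finset.univ.filter (p · < x)).image p',
        ∀ z ∈ (Finset.univ.filter (x < p ·)).image p', y < z := by
      simp only [Finset.mem_image, Finset.mem_filter, Finset.mem_univ, true_and]
      rintro _ ⟨i, hi, rfl⟩ _ ⟨j, hj, rfl⟩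
      have h := hsign i j
      rw [sign_pos (sub_pos.2 (hi.trans hj))] at h
      exact sub_pos.1 (sign_eq_one_iff.1 h.symm)
    obtain ⟨a, ha, ha'⟩ := Order.exists_between_finsets _ _ hlohi
    obtain ⟨b, hb, hb'⟩ := Order.exists_between_finsets {a} _ (fun y hy z hz => by
      rw [Finset.mem_singleton.1 hy]
      exact ha' z hz)
    refine ⟨a, b, hb a (Finset.mem_singleton_self a), fun i hi => ha _ ?_, fun i hi => hb' _ ?_⟩
    · exact Finset.mem_image_of_mem _ (by simpa using hi)
    · exact Finset.mem_image_of_mem _ (by simpa using hi)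
  have key : ∀ x', a < x' → x' < b → ∀ i,
      SignType.sign (x - p i) = SignType.sign (x' - p' i) := by
    intro x' h1 h2 i
    rcases lt_or_gt_of_ne (hx i) with h | h
    · rw [sign_pos (sub_pos.2 h), sign_pos (sub_pos.2 ((ha i h).trans h1))]
    · rw [sign_neg (sub_neg.2 h), sign_neg (sub_neg.2 (h2.trans (hb i h)))]
  by_cases hW : ∃ j, x - p j ∈ W
  · obtain ⟨j, hj⟩ := hW
    obtain ⟨x', hx', h1, h2⟩ := exists_sub_mem_between hdense (p' j) hab
    refine ⟨x', fun i => ⟨key x' h1 h2 i, ?_⟩⟩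
    rw [← sub_add_sub_cancel x (p j) (p i), ← sub_add_sub_cancel x' (p' j) (p' i),
      W.add_mem_iff_right hj, W.add_mem_iff_right hx', hmem]
  · push Not at hW
    obtain ⟨u, hu⟩ := exists_forall_sub_notMem hproper p'
    obtain ⟨x', hx', h1, h2⟩ := exists_sub_mem_between hdense u hab
    refine ⟨x', fun i => ⟨key x' h1 h2 i, iff_of_false (hW i) fun h => hu i ?_⟩⟩
    rw [← sub_add_sub_cancel x' u] at h
    exact (W.add_mem_iff_right hx').1 h

variable [IsOrderedModule K V]

/-- The back-and-forth step: the pattern of a finite set `F` of forms in the variables `x, t` is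
controlled by finitely many forms in the variables `x` alone. These are, writing the members of `F`
as `q i + c i • t`, the differences of the roots `-(c i)⁻¹ • q i` in `t`, and the `q i`. -/
theorem exists_finite_samePattern_snoc {W : Submodule K V} (hproper : W ≠ ⊤)
    (hdense : ∀ a b : V, a < b → ∃ w ∈ W, a < w ∧ w < b) {α : Type*} [Fintype α] {n : ℕ}
    {F : Set ((α ⊕ Fin (n + 1) → K) × V)} (hF : F.Finite) :
    ∃ G : Set ((α ⊕ Fin n → K) × V), G.Finite ∧ ∀ (a a' : α → V) (x x' : Fin n → V),
      SamePattern W G (Sum.elim a x) (Sum.elim a' x') → ∀ t, ∃ t',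
        SamePattern W F (Sum.elim a (Fin.snoc x t : Fin (n + 1) → V))
          (Sum.elim a' (Fin.snoc x' t' : Fin (n + 1) → V)) := by
  have := hF.to_subtype
  let q : F → (α ⊕ Fin n → K) × V := fun f =>
    (Sum.elim (f.1.1 ∘ Sum.inl) (Fin.init (f.1.1 ∘ Sum.inr)), f.1.2)
  let c : F → K := fun f => f.1.1 (Sum.inr (Fin.last n))
  refine ⟨Set.range q ∪ Set.range fun i : F × F => (c i.1)⁻¹ • q i.1 - (c i.2)⁻¹ • q i.2,
    (Set.finite_range _).union (Set.finite_range _), fun a a' x x' h t => ?_⟩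
  have h1 := fun i => h (q i) (Or.inl ⟨i, rfl⟩)
  have h2 := fun i j => h _ (Or.inr ⟨(i, j), rfl⟩)
  simp only [map_sub, map_smul, Pi.sub_apply, Pi.smul_apply] at h2
  obtain ⟨t', ht'⟩ := exists_extension hproper hdense
    (p := fun i => -((c i)⁻¹ • affineForm (q i) (Sum.elim a x)))
    (p' := fun i => -((c i)⁻¹ • affineForm (q i) (Sum.elim a' x')))
    (fun i j => by simpa only [neg_sub_neg] using (h2 i j).1)
    (fun i j => by simpa only [neg_sub_neg] using (h2 i j).2) t
  refine ⟨t', fun f hf => ?_⟩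
  have h3 := ht' ⟨f, hf⟩
  have h4 := h1 ⟨f, hf⟩
  simp only [affineForm_sumElim_snoc]
  change SignType.sign (affineForm (q ⟨f, hf⟩) _ + c ⟨f, hf⟩ • t) =
    SignType.sign (affineForm (q ⟨f, hf⟩) _ + c ⟨f, hf⟩ • t') ∧
    (affineForm (q ⟨f, hf⟩) _ + c ⟨f, hf⟩ • t ∈ W ↔
      affineForm (q ⟨f, hf⟩) _ + c ⟨f, hf⟩ • t' ∈ W)
  by_cases hc : c ⟨f, hf⟩ = 0
  · simpa only [hc, zero_smul, add_zero] using h4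
  · have h5 : ∀ y s : V, y + c ⟨f, hf⟩ • s = c ⟨f, hf⟩ • (s - -((c ⟨f, hf⟩)⁻¹ • y)) := by
      intro y s
      rw [sub_neg_eq_add, smul_add, smul_inv_smul₀ hc, add_comm]
    rw [h5, h5, sign_smul_eq_mul, sign_smul_eq_mul, W.smul_mem_iff hc, W.smul_mem_iff hc, h3.1]
    exact ⟨rfl, h3.2⟩

/-- Quantifier elimination, in semantic form: the truth value of a formula is determined by the
signs and the memberships in `W` of finitely many affine forms. -/
theorem exists_finite_samePattern_realize_iff {W : Submodule K V} (hproper : W ≠ ⊤)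
    (hdense : ∀ a b : V, a < b → ∃ w ∈ W, a < w ∧ w < b) (e : V) {α : Type*} [Fintype α] {n : ℕ}
    (φ : (ovsPairLanguage K).BoundedFormula α n) :
    letI : (ovsPairLanguage K).Structure V := ovsPairStructure W e
    ∃ F : Set ((α ⊕ Fin n → K) × V), F.Finite ∧ ∀ (a a' : α → V) (x x' : Fin n → V),
      SamePattern W F (Sum.elim a x) (Sum.elim a' x') → (φ.Realize a x ↔ φ.Realize a' x') := by
  let : (ovsPairLanguage K).Structure V := ovsPairStructure W e
  induction φ with
  | falsum => exact ⟨∅, Set.finite_empty, fun _ _ _ _ _ => Iff.rfl⟩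
  | equal t₁ t₂ =>
    obtain ⟨f₁, h₁⟩ := exists_affineForm_eq_realize W e t₁
    obtain ⟨f₂, h₂⟩ := exists_affineForm_eq_realize W e t₂
    refine ⟨{f₁ - f₂}, Set.finite_singleton _, fun a a' x x' h => ?_⟩
    have h3 := (h _ rfl).1
    simp only [map_sub, Pi.sub_apply] at h3
    simp only [FirstOrder.Language.BoundedFormula.Realize, h₁, h₂]
    rw [← sub_eq_zero, ← sign_eq_zero_iff, h3, sign_eq_zero_iff, sub_eq_zero]
  | rel R ts =>
    choose f hf using fun i => exists_affineForm_eq_realize W e (ts i)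
    cases R with
    | U =>
      refine ⟨{f 0}, Set.finite_singleton _, fun a a' x x' h => ?_⟩
      have h3 := (h _ rfl).2
      rw [← hf, ← hf] at h3
      exact h3
    | lt =>
      refine ⟨{f 1 - f 0}, Set.finite_singleton _, fun a a' x x' h => ?_⟩
      have h3 := (h _ rfl).1
      simp only [map_sub, Pi.sub_apply, ← hf] at h3
      change (ts 0).realize _ < (ts 1).realize _ ↔ (ts 0).realize _ < (ts 1).realize _
      rw [← sub_pos, ← sign_eq_one_iff, h3, sign_eq_one_iff, sub_pos]
  | imp φ ψ ihφ ihψ =>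
    obtain ⟨F, hF, h₁⟩ := ihφ
    obtain ⟨G, hG, h₂⟩ := ihψ
    refine ⟨F ∪ G, hF.union hG, fun a a' x x' h => ?_⟩
    simp only [FirstOrder.Language.BoundedFormula.realize_imp,
      h₁ a a' x x' (h.mono Set.subset_union_left), h₂ a a' x x' (h.mono Set.subset_union_right)]
  | all φ ih =>
    obtain ⟨F, hF, h₁⟩ := ih
    obtain ⟨G, hG, h₂⟩ := exists_finite_samePattern_snoc hproper hdense hF
    have key : ∀ (a a' : α → V) (x x' : Fin _ → V),
        SamePattern W G (Sum.elim a x) (Sum.elim a' x') →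
        φ.all.Realize a x → φ.all.Realize a' x' := by
      intro a a' x x' h hφ t'
      obtain ⟨t, ht⟩ := h₂ _ _ _ _ h.symm t'
      exact (h₁ _ _ _ _ ht).2 (hφ t)
    exact ⟨G, hG, fun a a' x x' h => ⟨key _ _ _ _ h, key _ _ _ _ h.symm⟩⟩

end QuantifierElimination

/-! ### Counting patterns of affine forms -/

section Counting

theorem ncard_range_le_card_mul {X Y I P Q : Type*} [Finite Q] [Fintype I] {f : X → P}
    {g : I → Y → Q} {r : X → Y} {dec : I → Q → P} (h : ∀ x, ∃ i, f x = dec i (g i (r x))) {B : ℕ}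
    (hB : ∀ i, (Set.range (g i)).ncard ≤ B) :
    (Set.range f).ncard ≤ Fintype.card I * B := by
  have hsub : Set.range f ⊆ ⋃ i, dec i '' Set.range (g i) := by
    rintro _ ⟨x, rfl⟩
    obtain ⟨i, hi⟩ := h x
    exact Set.mem_iUnion.2 ⟨i, _, ⟨r x, rfl⟩, hi.symm⟩
  calc (Set.range f).ncard
      ≤ (⋃ i, dec i '' Set.range (g i)).ncard :=
        Set.ncard_le_ncard hsub (Set.finite_iUnion fun i => (Set.toFinite _).image _)
    _ ≤ ∑ i : I, (dec i '' Set.range (g i)).ncard := Set.ncard_iUnion_le_of_fintype _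
    _ ≤ ∑ _i : I, B :=
        Finset.sum_le_sum fun i _ => (Set.ncard_image_le (Set.toFinite _)).trans (hB i)
    _ = Fintype.card I * B := by simp

variable {K : Type u} {V : Type v} [Field K] [AddCommGroup V] [Module K V]

/-- Suppose that for the forms `q i + c i • t` in one variable `t` the pattern `i ↦ pat _` can be
computed from one of `|I|` choices together with the pattern of linear combinations
`a i • q i + b i • q (s i)`, where `a`, `b`, `s` depend only on `c` and on the choice. Then a family
of affine forms on `V ^ n` has at most `|I| ^ n` patterns: each variable costs one choice, and
the number of forms does not grow. -/
theorem ncard_range_pattern_le {P : Type*} [Finite P] (pat : V → P) {I ι : Type*} [Fintype I]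
    [Finite ι]
    (helim : ∀ c : ι → K, ∃ (a b : I → ι → K) (s : I → ι → ι) (dec : I → (ι → P) → ι → P),
      ∀ (q : ι → V) (t : V), ∃ o, (fun i => pat (q i + c i • t)) =
        dec o fun i => pat (a o i • q i + b o i • q (s o i)))
    {n : ℕ} (f : ι → (Fin n → K) × V) :
    (Set.range fun (x : Fin n → V) i => pat (affineForm (f i) x)).ncard ≤ Fintype.card I ^ n := by
  induction n with
  | zero =>
    rw [pow_zero, Set.ncard_le_one]
    rintro _ ⟨x, rfl⟩ _ ⟨y, rfl⟩
    rw [Subsingleton.elim x y]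
  | succ n ih =>
    obtain ⟨a, b, s, dec, h⟩ := helim fun i => (f i).1 (Fin.last n)
    let q : ι → (Fin n → K) × V := fun i => (Fin.init (f i).1, (f i).2)
    rw [pow_succ']
    refine ncard_range_le_card_mul (r := Fin.init) (dec := dec) (g := fun o x i =>
      pat (affineForm (a o i • q i + b o i • q (s o i)) x)) (fun x => ?_) fun o => ih _
    obtain ⟨o, ho⟩ := h (fun i => affineForm (q i) (Fin.init x)) (x (Fin.last n))
    refine ⟨o, ?_⟩
    simp only [map_add, map_smul, Pi.add_apply, Pi.smul_apply]
    rw [← ho]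
    funext i
    rw [← affineForm_snoc, Fin.snoc_init_self]

/-- To decide which of the forms `q i + c i • t` with `c i ≠ 0` vanish modulo `W`, choose one of
them, if there is any, and compare its root with the roots of the others. -/
theorem ncard_range_mem_pattern_le (W : Submodule K V) {ι : Type*} [Fintype ι] {n : ℕ}
    (f : ι → (Fin n → K) × V) :
    (Set.range fun (x : Fin n → V) i => affineForm (f i) x ∈ W).ncard ≤
      (Fintype.card ι + 1) ^ n := by
  classical
  rw [← Fintype.card_option]
  refine ncard_range_pattern_le (· ∈ W) (I := Option ι) (fun c => ⟨
    fun o i => o.elim 1 fun _ => if c i = 0 then 1 else (c i)⁻¹,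
    fun o i => o.elim 0 fun j => if c i = 0 then 0 else -(c j)⁻¹,
    fun o i => o.elim i id,
    fun o r i => o.elim (if c i = 0 then r i else False) fun _ => r i, fun q t => ?_⟩) f
  by_cases h : ∃ j, c j ≠ 0 ∧ q j + c j • t ∈ W
  · obtain ⟨j, hj, hjW⟩ := h
    refine ⟨some j, funext fun i => ?_⟩
    by_cases hi : c i = 0
    · simp [hi]
    · have h1 : q i + c i • t = c i • (((c i)⁻¹ • q i + -(c j)⁻¹ • q j) +
          (c j)⁻¹ • (q j + c j • t)) := by
        simp only [smul_add, neg_smul, smul_inv_smul₀ hi, inv_smul_smul₀ hj]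
        simp
      simp only [Option.elim, hi, if_false, id]
      rw [h1, W.smul_mem_iff hi, W.add_mem_iff_left (W.smul_mem _ hjW)]
  · push Not at h
    refine ⟨none, funext fun i => ?_⟩
    by_cases hi : c i = 0
    · simp [hi]
    · simp [hi, h i hi]

variable [LinearOrder K] [IsStrictOrderedRing K] [LinearOrder V] [IsOrderedAddMonoid V]
  [IsOrderedModule K V]

/-- To find the signs of the forms `q i + c i • t` with `c i ≠ 0`, choose the one with the largest
root that is at most `t`, if there is any, record whether this root equals `t`, and compare it with
the other roots. -/
theorem ncard_range_sign_pattern_le {ι : Type*} [Fintype ι] {n : ℕ}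
    (f : ι → (Fin n → K) × V) :
    (Set.range fun (x : Fin n → V) i => SignType.sign (affineForm (f i) x)).ncard ≤
      (2 * Fintype.card ι + 1) ^ n := by
  classical
  have hcard : 2 * Fintype.card ι + 1 = Fintype.card (Option (ι × Bool)) := by
    simp [mul_comm]
  rw [hcard]
  refine ncard_range_pattern_le SignType.sign (I := Option (ι × Bool)) (fun c => ⟨
    fun o i => o.elim 1 fun _ => if c i = 0 then 1 else (c i)⁻¹,
    fun o i => o.elim 0 fun j => if c i = 0 then 0 else -(c j.1)⁻¹,
    fun o i => o.elim i Prod.fst,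
    fun o r i => if c i = 0 then r i else SignType.sign (c i) *
      o.elim (-1) fun j => if j.2 then r i else if r i = -1 then -1 else 1, fun q t => ?_⟩) f
  let p : ι → V := fun i => -((c i)⁻¹ • q i)
  have hp : ∀ i, c i ≠ 0 → SignType.sign (q i + c i • t) =
      SignType.sign (c i) * SignType.sign (t - p i) := by
    intro i hi
    rw [← sign_smul_eq_mul, sub_neg_eq_add, smul_add, smul_inv_smul₀ hi, add_comm]
  have hpp : ∀ i j, (c i)⁻¹ • q i + -(c j)⁻¹ • q j = p j - p i := by
    intro i j
    simp only [p, neg_smul, neg_sub_neg, ← sub_eq_add_neg]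
  rcases (Finset.univ.filter fun i => c i ≠ 0 ∧ p i ≤ t).eq_empty_or_nonempty with h | h
  · refine ⟨none, funext fun i => ?_⟩
    by_cases hi : c i = 0
    · simp [hi]
    · have h1 : t < p i := by
        by_contra! h2
        exact Finset.notMem_empty i (h ▸ Finset.mem_filter.2 ⟨Finset.mem_univ i, hi, h2⟩)
      simp [hi, hp i hi, sign_neg (sub_neg.2 h1)]
  · obtain ⟨j, hj, hmax⟩ := Finset.exists_max_image _ p h
    simp only [Finset.mem_filter, Finset.mem_univ, true_and] at hj hmax
    refine ⟨some (j, decide (p j = t)), funext fun i => ?_⟩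
    by_cases hi : c i = 0
    · simp [hi]
    simp only [hp i hi, Option.elim, hi, if_false, hpp, decide_eq_true_eq]
    congr 1
    split_ifs with h1 h2
    · rw [h1]
    · rw [sign_eq_neg_one_iff, sub_neg] at h2
      rw [sign_eq_neg_one_iff, sub_neg]
      by_contra! h3
      exact (hmax i ⟨hi, h3⟩).not_gt h2
    · rw [sign_eq_neg_one_iff, sub_neg, not_lt] at h2
      rw [sign_eq_one_iff, sub_pos]
      exact h2.trans_lt (lt_of_le_of_ne hj.2 h1)

end Counting

/-! ### The bound on the VC-density -/

theorem ncard_range_le_mul {X P Q R : Type*} [Finite P] [Finite Q] (g : X → P) (h : X → Q)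
    (f : X → R) (hf : ∀ x y, g x = g y → h x = h y → f x = f y) :
    (Set.range f).ncard ≤ (Set.range g).ncard * (Set.range h).ncard := by
  classical
  rw [← Set.ncard_prod]
  have hfac : Function.FactorsThrough f fun x => (g x, h x) := fun x y hxy =>
    hf x y (Prod.ext_iff.1 hxy).1 (Prod.ext_iff.1 hxy).2
  rcases isEmpty_or_nonempty X with hX | ⟨⟨x₀⟩⟩
  · simp [Set.range_eq_empty]
  have : Set.range f ⊆ Function.extend (fun x => (g x, h x)) f (fun _ => f x₀) ''
      (Set.range g ×ˢ Set.range h) := by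
    rintro _ ⟨x, rfl⟩
    exact ⟨(g x, h x), ⟨⟨x, rfl⟩, ⟨x, rfl⟩⟩, hfac.extend_apply _ x⟩
  exact (Set.ncard_le_ncard this ((Set.toFinite _).image _)).trans
    (Set.ncard_image_le (Set.toFinite _))

theorem vcDensity_le_of_shatterFunction_le {L : FirstOrder.Language.{u, v}} {M : Type w}
    [L.Structure M] {m n : ℕ} (φ : L.Formula (Fin m ⊕ Fin n)) (C d : ℕ)
    (h : ∀ k, 1 ≤ k → shatterFunction M φ k ≤ C * k ^ d) :
    vcDensity M φ ≤ ((d : ℕ) : EReal) := by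
  refine sInf_le ⟨(d : ℝ), by simp, IsBigO.of_bound (C : ℝ) ?_⟩
  filter_upwards [eventually_ge_atTop 1] with k hk
  rw [Real.rpow_natCast, Real.norm_natCast, norm_pow, Real.norm_natCast]
  exact_mod_cast h k hk

theorem mainTheorem1 {K : Type u} {V : Type v}
    [Field K] [LinearOrder K] [IsStrictOrderedRing K]
    [AddCommGroup V] [LinearOrder V] [IsOrderedAddMonoid V]
    [Module K V] [IsOrderedModule K V]
    (W : Submodule K V) (hproper : W ≠ ⊤)
    (hdense : ∀ a b : V, a < b → ∃ w ∈ W, a < w ∧ w < b)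
    (e : V) (heW : e ∈ W) (he : 0 < e)
    {m n : ℕ} (φ : (ovsPairLanguage K).Formula (Fin m ⊕ Fin n)) :
    letI : (ovsPairLanguage K).Structure V := ovsPairStructure W e
    vcDensity V φ ≤ ((2 * n : ℕ) : EReal) := by
  let : (ovsPairLanguage K).Structure V := ovsPairStructure W e
  obtain ⟨F, hF, hφ⟩ := exists_finite_samePattern_realize_iff hproper hdense e φ
  have := hF.fintype
  set N := Fintype.card F
  refine vcDensity_le_of_shatterFunction_le φ (((2 * N + 1) * (N + 1)) ^ n) (2 * n) fun k hk =>
    csSup_le' ?_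
  rintro _ ⟨A, hA, rfl⟩
  -- Specializing the object variables to the points of `A` gives `N * k` forms in the parameters.
  let g : F × A → (Fin n → K) × V := fun i =>
    (i.1.1.1 ∘ Sum.inl ∘ Sum.inr,
      affineForm (i.1.1.1 ∘ Sum.inl ∘ Sum.inl,
        affineForm (i.1.1.1 ∘ Sum.inr, i.1.1.2) default) i.2.1)
  have hg : ∀ (i : F × A) (b : Fin n → V), affineForm i.1.1 (Sum.elim (Sum.elim i.2.1 b) default) =
      affineForm (g i) b := by
    intro i b
    simp only [affineForm_apply, Fintype.sum_sum_type, Sum.elim_inl, Sum.elim_inr, g,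
      Function.comp_apply]
    abel
  have hcard : Fintype.card (F × A) = N * k := by
    rw [Fintype.card_prod, Fintype.card_coe, hA]
  have hrange : traceFamily V φ (A : Set (Fin m → V)) =
      Set.range fun b : Fin n → V => (A : Set (Fin m → V)) ∩ definedSet V φ b := by
    ext S
    simp only [traceFamily, Set.mem_ofPred_eq, Set.mem_range, eq_comm]
  calc (traceFamily V φ (A : Set (Fin m → V))).ncard
      ≤ (Set.range fun (b : Fin n → V) i => SignType.sign (affineForm (g i) b)).ncard *
        (Set.range fun (b : Fin n → V) i => affineForm (g i) b ∈ W).ncard := by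
        rw [hrange]
        refine ncard_range_le_mul _ _ _ fun b b' hs hW => Set.ext fun a => ?_
        refine and_congr_right fun ha => hφ _ _ _ _ fun f hf => ?_
        rw [hg (⟨f, hf⟩, ⟨a, ha⟩) b, hg (⟨f, hf⟩, ⟨a, ha⟩) b']
        exact ⟨congrFun hs _, iff_of_eq (congrFun hW _)⟩
    _ ≤ (2 * (N * k) + 1) ^ n * (N * k + 1) ^ n := by
        have h1 := ncard_range_sign_pattern_le g
        have h2 := ncard_range_mem_pattern_le W g
        rw [hcard] at h1 h2
        exact Nat.mul_le_mul h1 h2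
    _ ≤ ((2 * N + 1) * k) ^ n * ((N + 1) * k) ^ n := by
        gcongr <;> nlinarith
    _ = ((2 * N + 1) * (N + 1)) ^ n * k ^ (2 * n) := by
        rw [← mul_pow, pow_mul, ← mul_pow]
        ring
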